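/- Let $\mathbf H$ be the skew field of real quaternions. For $B=(b_{ij})\in\mathbf H^{n\times n}$ and $i\in\{1,\dots,n\}$, the $i$th row determinant of $B$ is $$\operatorname{rdet}_i B=\sum_{\sigma\in S_n}\operatorname{sgn}(\sigma)\,c_1(\sigma)c_2(\sigma)\cdots c_r(\sigma),$$ where $\sigma$ has exactly $r$ disjoint cycles (fixed points count as cycles of length $1$), each $c_t(\sigma)=b_{x\,\sigma(x)}\,b_{\sigma(x)\,\sigma^2(x)}\cdots b_{\sigma^{-1}(x)\,x}$ is the ordered product along one cycle starting from an opening element $x$, the first cycle is the one through $i$ and is opened by $i$, and each of the other cycles is opened by its least element, these cycles being arranged in increasing order of their least elements. The $i$th column determinant $\operatorname{cdet}_i B$ is defined by the same sum with $c_1(\sigma)c_2(\sigma)\cdots c_r(\sigma)$ replaced by $c_r(\sigma)\cdots c_2(\sigma)c_1(\sigma)$. The determinant $\det B$ of a Hermitian matrix $B$ is the common value of all its row and column determinants (and $\det B=1$ if $n=0$). Theorem 6.6. Let $A\in\mathbf H^{m\times n}$ and let $A^*$ be its conjugate transpose. Then all the row determinants $\operatorname{rdet}_i(A^*A)$ and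 all the column determinants $\operatorname{cdet}_i(A^*A)$, $i=1,\dots,n$, coincide, so that $\det(A^*A)$ is well defined, and the following conditions are equivalent: 1. $\det(A^*A)\neq 0$; 2. the columns of $A$ are right-linearly independent over $\mathbf H$; 3. the rows of $A^*$ are left-linearly independent over $\mathbf H$. -/

import Mathlib

open scoped Quaternion Matrix

noncomputable section

/-- The product of the entries of `A` along the cycle of `σ` through `x`, opened at `x`:
`A x (σ x) * A (σ x) (σ² x) * ⋯ * A (σ⁻¹ x) x`. It is `A x x` if `σ` fixes `x`. -/
def cycleProd {n : ℕ} (A : Matrix (Fin n) (Fin n) ℍ[ℝ]) (σ : Equiv.Perm (Fin n)) (x : Fin n) :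
    ℍ[ℝ] :=
  ((List.range (Function.minimalPeriod σ x)).map
    fun k => A ((σ ^ k) x) ((σ ^ (k + 1)) x)).prod

/-- The opening elements of the cycles of `σ` (fixed points are cycles of length one), listed
once per cycle: first `i`, for the cycle through `i`, then the least element of each of the
other cycles, in increasing order. -/
def cycleOpeners {n : ℕ} (σ : Equiv.Perm (Fin n)) (i : Fin n) : List (Fin n) :=
  i :: (List.finRange n).filter fun x =>
    decide (¬ σ.SameCycle i x ∧ ∀ y, σ.SameCycle x y → x ≤ y)

/-- The `i`-th row determinant: the signed sum over all permutations of the products of the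
cycle products, where the cycle through `i` is the first factor from the left and the other
cycles follow, from left to right, in increasing order of their least (opening) elements. -/
def rdet {n : ℕ} (i : Fin n) (A : Matrix (Fin n) (Fin n) ℍ[ℝ]) : ℍ[ℝ] :=
  ∑ σ : Equiv.Perm (Fin n),
    (Equiv.Perm.sign σ : ℤ) • ((cycleOpeners σ i).map (cycleProd A σ)).prod

/-- The `j`-th column determinant: as the row determinant, but the cycle through `j` is the
first factor from the right and the other cycles follow from right to left. Each cycle still
reads `A j (τ j) * ⋯ * A (τ⁻¹ j) j` from left to right. -/
def cdet {n : ℕ} (j : Fin n) (A : Matrix (Fin n) (Fin n) ℍ[ℝ]) : ℍ[ℝ] :=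
  ∑ τ : Equiv.Perm (Fin n),
    (Equiv.Perm.sign τ : ℤ) • ((cycleOpeners τ j).reverse.map (cycleProd A τ)).prod

/-- The determinant of a Hermitian quaternion matrix, which is the common value of all its row
and column determinants; it is read off here from the first row (and is `1` for the empty
matrix). It is meant for Hermitian matrices only. -/
def hermDet : {n : ℕ} → Matrix (Fin n) (Fin n) ℍ[ℝ] → ℍ[ℝ]
  | 0, _ => 1
  | _ + 1, A => rdet 0 A

end

/-!
Inverting one cycle of a permutation keeps its sign, its opening elements and its other cycle
products, and for a Hermitian matrix it conjugates the product of that cycle. Averaging over such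
inversions, every cycle product may be replaced by its real part (`sum_prod_cycleProd_eq`). Real
parts commute and do not depend on the opening element, so all row and column determinants of a
Hermitian matrix are equal to one real number, `mooreDet`.

Replacing row `j` of a Hermitian matrix by row `i ≠ j` makes the `j`-th row determinant vanish
(`rdet_eq_zero_of_row_eq`). To see this, pair a permutation `τ` that has `i` and `j` in different
cycles with `τ * swap i j`, which merges these cycles. The two terms add up to a multiple of
`Re c - c`, where `c` is the product of the cycle of `τ` through `i`, and such terms cancel when
that cycle is inverted. Since row determinants are left linear in their own row, the cofactors
along row `j` thus form a vector `v` with `B v = det B • e_j` (`mulVec_rowCofactor`).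

For `B = Aᴴ * A` with nonzero determinant, these vectors form a right inverse of `B` up to a scalar,
and hence `A v = 0` only for `v = 0`. Conversely let `A` have trivial kernel. Then so has every
principal part of `B`, that is, `B` on a set `S` of indices and the identity elsewhere, because
`star v ⬝ᵥ B *ᵥ v` is the sum of the squared norms of the entries of `A v`. If the principal
minor on `S` is nonzero and `j ∉ S`, it is the `j`-th coordinate of the cofactor vector of the
principal part on `insert j S`; this vector is then nonzero and so not in the kernel, whence the
minor on `insert j S` is nonzero. By induction on `S` the determinant of `B` is nonzero.
-/

/-! ### Products along a cycle -/

section CycleProducts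

variable {n : ℕ} {M M' : Matrix (Fin n) (Fin n) ℍ[ℝ]} {σ σ' : Equiv.Perm (Fin n)} {x y : Fin n}

/-- The product of the first `k` entries of `M` met along the orbit of `x` under `σ`. -/
noncomputable def pathProd (M : Matrix (Fin n) (Fin n) ℍ[ℝ]) (σ : Equiv.Perm (Fin n)) (x : Fin n) (k : ℕ) :
    ℍ[ℝ] :=
  ((List.range k).map fun t => M ((σ ^ t) x) ((σ ^ (t + 1)) x)).prod

lemma cycleProd_eq_pathProd (M : Matrix (Fin n) (Fin n) ℍ[ℝ]) (σ : Equiv.Perm (Fin n))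
    (x : Fin n) : cycleProd M σ x = pathProd M σ x (Function.minimalPeriod σ x) := rfl

@[simp] lemma pathProd_zero : pathProd M σ x 0 = 1 := by simp [pathProd]

lemma pathProd_succ (k : ℕ) :
    pathProd M σ x (k + 1) = pathProd M σ x k * M ((σ ^ k) x) ((σ ^ (k + 1)) x) := by
  simp [pathProd, List.range_succ]

lemma pathProd_add (a b : ℕ) :
    pathProd M σ x (a + b) = pathProd M σ x a * pathProd M σ ((σ ^ a) x) b := by
  induction b with
  | zero => simp
  | succ b ih =>
    rw [← add_assoc, pathProd_succ, ih, pathProd_succ, mul_assoc, ← Equiv.Perm.mul_apply,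
      ← Equiv.Perm.mul_apply, ← pow_add, ← pow_add, add_comm b a, add_right_comm b 1 a,
      add_comm b a]

lemma pathProd_succ_left (k : ℕ) :
    pathProd M σ x (k + 1) = M x (σ x) * pathProd M σ (σ x) k := by
  rw [add_comm, pathProd_add]
  simp [pathProd]

lemma pathProd_congr {l : ℕ} (h : ∀ k < l, M ((σ ^ k) x) ((σ ^ (k + 1)) x) =
    M' ((σ' ^ k) y) ((σ' ^ (k + 1)) y)) : pathProd M σ x l = pathProd M' σ' y l := by
  unfold pathProd
  congr 1
  exact List.map_congr_left fun k hk => h k (List.mem_range.1 hk)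

lemma isPeriodicPt_iff_pow {k : ℕ} : Function.IsPeriodicPt σ k x ↔ (σ ^ k) x = x := by
  rw [Function.IsPeriodicPt, Function.IsFixedPt, Equiv.Perm.iterate_eq_pow]

lemma pow_minimalPeriod_apply : (σ ^ Function.minimalPeriod σ x) x = x :=
  isPeriodicPt_iff_pow.1 (Function.isPeriodicPt_minimalPeriod _ _)

lemma minimalPeriod_perm_pos (σ : Equiv.Perm (Fin n)) (x : Fin n) :
    0 < Function.minimalPeriod σ x := by
  apply Function.IsPeriodicPt.minimalPeriod_pos (orderOf_pos σ)
  rw [isPeriodicPt_iff_pow, pow_orderOf_eq_one]; rfl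

lemma sameCycle_iff_exists_nat : σ.SameCycle x y ↔ ∃ k : ℕ, (σ ^ k) x = y :=
  ⟨fun h => let ⟨k, _, _, hk⟩ := h.exists_pow_eq''; ⟨k, hk⟩, fun ⟨k, hk⟩ => ⟨k, by simpa using hk⟩⟩

lemma sameCycle_pow_right_self (k : ℕ) : σ.SameCycle x ((σ ^ k) x) := ⟨k, by simp⟩

/-- Permutations that agree on the cycle of `σ` through `x` have the same orbit of `x`. -/
lemma pow_apply_eq_of_agree (h : ∀ y, σ.SameCycle x y → σ' y = σ y) (k : ℕ) :
    (σ' ^ k) x = (σ ^ k) x := by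
  induction k with
  | zero => rfl
  | succ k ih =>
    rw [pow_succ', pow_succ', Equiv.Perm.mul_apply, Equiv.Perm.mul_apply, ih,
      h _ (sameCycle_pow_right_self k)]

lemma sameCycle_iff_of_agree (h : ∀ y, σ.SameCycle x y → σ' y = σ y) :
    σ'.SameCycle x y ↔ σ.SameCycle x y := by
  simp only [sameCycle_iff_exists_nat, pow_apply_eq_of_agree h]

lemma minimalPeriod_eq_of_agree (h : ∀ y, σ.SameCycle x y → σ' y = σ y) :
    Function.minimalPeriod σ' x = Function.minimalPeriod σ x := by
  rw [Function.minimalPeriod_eq_minimalPeriod_iff]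
  intro k
  rw [isPeriodicPt_iff_pow, isPeriodicPt_iff_pow, pow_apply_eq_of_agree h]

lemma cycleProd_eq_of_agree (h : ∀ y, σ.SameCycle x y → σ' y = σ y)
    (hM : ∀ y, σ.SameCycle x y → M' y (σ y) = M y (σ y)) :
    cycleProd M' σ' x = cycleProd M σ x := by
  rw [cycleProd_eq_pathProd, cycleProd_eq_pathProd, minimalPeriod_eq_of_agree h]
  refine pathProd_congr fun k _ => ?_
  rw [pow_apply_eq_of_agree h, pow_apply_eq_of_agree h, pow_succ', Equiv.Perm.mul_apply,
    hM _ (sameCycle_pow_right_self k)]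

lemma re_mul_comm (a b : ℍ[ℝ]) : (a * b).re = (b * a).re := by
  simp only [Quaternion.re_mul]; ring

/-- The real part of a cycle product does not depend on the opening element. -/
lemma re_cycleProd_eq_of_sameCycle (M : Matrix (Fin n) (Fin n) ℍ[ℝ]) (h : σ.SameCycle x y) :
    (cycleProd M σ y).re = (cycleProd M σ x).re := by
  obtain ⟨k, rfl⟩ := sameCycle_iff_exists_nat.1 h
  clear h
  induction k with
  | zero => rfl
  | succ k ih =>
    rw [← ih, pow_succ', Equiv.Perm.mul_apply]
    clear ih
    generalize (σ ^ k) x = z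
    obtain ⟨p, hp⟩ := Nat.exists_eq_succ_of_ne_zero (minimalPeriod_perm_pos σ z).ne'
    have hz : (σ ^ (p + 1)) z = z := by rw [← Nat.succ_eq_add_one, ← hp, pow_minimalPeriod_apply]
    have hq : Function.minimalPeriod σ (σ z) = Function.minimalPeriod σ z :=
      Function.minimalPeriod_apply (Function.mem_periodicPts.2
        ⟨_, minimalPeriod_perm_pos σ z, Function.isPeriodicPt_minimalPeriod _ _⟩)
    have hs : ∀ k, (σ ^ k) (σ z) = (σ ^ (k + 1)) z := fun k => by
      rw [pow_succ, Equiv.Perm.mul_apply]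
    rw [cycleProd_eq_pathProd, cycleProd_eq_pathProd, hq, hp, Nat.succ_eq_add_one,
      pathProd_succ, pathProd_succ_left, hs, hs, hz, pow_succ', Equiv.Perm.mul_apply, hz,
      re_mul_comm]

/-- For entries that are Hermitian along a cycle, running through the cycle backwards conjugates
its product. -/
lemma cycleProd_inv_eq_star
    (h : ∀ y z, σ.SameCycle x y → σ.SameCycle x z → M y z = star (M z y)) :
    cycleProd M σ⁻¹ x = star (cycleProd M σ x) := by
  have key : ∀ k, pathProd M σ⁻¹ ((σ ^ k) x) k = star (pathProd M σ x k) := by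
    intro k
    induction k with
    | zero => simp
    | succ k ih =>
      rw [pathProd_succ_left, pathProd_succ, star_mul, ← ih]
      have : σ⁻¹ ((σ ^ (k + 1)) x) = (σ ^ k) x := by
        rw [pow_succ', Equiv.Perm.mul_apply, Equiv.Perm.inv_def, Equiv.symm_apply_apply]
      rw [this, h _ _ (sameCycle_pow_right_self (k + 1)) (sameCycle_pow_right_self k)]
  have hp : Function.minimalPeriod (σ⁻¹ : Equiv.Perm (Fin n)) x = Function.minimalPeriod σ x := by
    rw [Function.minimalPeriod_eq_minimalPeriod_iff]
    intro k
    rw [isPeriodicPt_iff_pow, isPeriodicPt_iff_pow, inv_pow, Equiv.Perm.inv_eq_iff_eq, eq_comm]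
  have := key (Function.minimalPeriod σ x)
  rw [pow_minimalPeriod_apply] at this
  rw [cycleProd_eq_pathProd, hp, this, cycleProd_eq_pathProd]

end CycleProducts

/-! ### Inverting one cycle -/

section Flip

variable {n : ℕ}

/-- The permutation obtained from `σ` by inverting its cycle through `x`. -/
def flipCycle (x : Fin n) (σ : Equiv.Perm (Fin n)) : Equiv.Perm (Fin n) :=
  σ * σ⁻¹.cycleOf x * σ⁻¹.cycleOf x

variable {σ : Equiv.Perm (Fin n)} {x y z : Fin n}

lemma flipCycle_apply_of_sameCycle (h : σ.SameCycle x y) : flipCycle x σ y = σ⁻¹ y := by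
  have h' := Equiv.Perm.sameCycle_inv.2 h
  rw [flipCycle, Equiv.Perm.mul_apply, Equiv.Perm.mul_apply, h'.cycleOf_apply,
    (Equiv.Perm.sameCycle_apply_right.2 h').cycleOf_apply, ← Equiv.Perm.mul_apply σ,
    mul_inv_cancel, Equiv.Perm.one_apply]

lemma flipCycle_apply_of_not_sameCycle (h : ¬ σ.SameCycle x y) : flipCycle x σ y = σ y := by
  have h' := Equiv.Perm.cycleOf_apply_of_not_sameCycle (mt Equiv.Perm.sameCycle_inv.1 h)
  rw [flipCycle, Equiv.Perm.mul_apply, Equiv.Perm.mul_apply, h', h']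

lemma sign_flipCycle (x : Fin n) (σ : Equiv.Perm (Fin n)) :
    Equiv.Perm.sign (flipCycle x σ) = Equiv.Perm.sign σ := by
  rw [flipCycle, map_mul, map_mul, mul_assoc, Int.units_mul_self, mul_one]

lemma flipCycle_agree_inv (h : σ.SameCycle x y) :
    ∀ z, σ⁻¹.SameCycle y z → flipCycle x σ z = σ⁻¹ z := fun _ hz =>
  flipCycle_apply_of_sameCycle (h.trans (Equiv.Perm.sameCycle_inv.1 hz))

lemma flipCycle_agree (h : ¬ σ.SameCycle x y) :
    ∀ z, σ.SameCycle y z → flipCycle x σ z = σ z := fun _ hz =>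
  flipCycle_apply_of_not_sameCycle fun hx => h (hx.trans hz.symm)

lemma sameCycle_flipCycle : (flipCycle x σ).SameCycle y z ↔ σ.SameCycle y z := by
  by_cases h : σ.SameCycle x y
  · rw [sameCycle_iff_of_agree (flipCycle_agree_inv h), Equiv.Perm.sameCycle_inv]
  · exact sameCycle_iff_of_agree (flipCycle_agree h)

lemma flipCycle_flipCycle : flipCycle x (flipCycle x σ) = σ := by
  ext1 y
  by_cases h : σ.SameCycle x y
  · rw [flipCycle_apply_of_sameCycle (sameCycle_flipCycle.2 h), Equiv.Perm.inv_eq_iff_eq,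
      flipCycle_apply_of_sameCycle (Equiv.Perm.sameCycle_apply_right.2 h), eq_comm,
      Equiv.Perm.inv_eq_iff_eq]
  · rw [flipCycle_apply_of_not_sameCycle (mt sameCycle_flipCycle.1 h),
      flipCycle_apply_of_not_sameCycle h]

lemma cycleProd_flipCycle_of_not_sameCycle (M : Matrix (Fin n) (Fin n) ℍ[ℝ])
    (h : ¬ σ.SameCycle x y) : cycleProd M (flipCycle x σ) y = cycleProd M σ y :=
  cycleProd_eq_of_agree (flipCycle_agree h) fun _ _ => rfl

lemma cycleProd_flipCycle_self {M : Matrix (Fin n) (Fin n) ℍ[ℝ]}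
    (h : ∀ y z, σ.SameCycle x y → σ.SameCycle x z → M y z = star (M z y)) :
    cycleProd M (flipCycle x σ) x = star (cycleProd M σ x) := by
  rw [← cycleProd_inv_eq_star h]
  exact cycleProd_eq_of_agree (flipCycle_agree_inv (Equiv.Perm.SameCycle.refl _ _)) fun _ _ => rfl

lemma cycleOpeners_flipCycle (i : Fin n) : cycleOpeners (flipCycle x σ) i = cycleOpeners σ i := by
  simp only [cycleOpeners, sameCycle_flipCycle]

/-- Two functions on permutations have the same sum as soon as they have the same averages over
the pairs `{σ, flipCycle x σ}`. -/
lemma sum_eq_sum_of_flipCycle (x : Fin n) {f g : Equiv.Perm (Fin n) → ℍ[ℝ]}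
    (h : ∀ σ, f σ + f (flipCycle x σ) = g σ + g (flipCycle x σ)) : ∑ σ, f σ = ∑ σ, g σ := by
  have hs : ∀ f : Equiv.Perm (Fin n) → ℍ[ℝ], ∑ σ, f (flipCycle x σ) = ∑ σ, f σ := fun f =>
    Equiv.sum_comp (Function.Involutive.toPerm (flipCycle x) fun _ => flipCycle_flipCycle) f
  have h2 : ∑ σ, (f σ + f (flipCycle x σ)) = ∑ σ, (g σ + g (flipCycle x σ)) :=
    Finset.sum_congr rfl fun σ _ => h σ
  rw [Finset.sum_add_distrib, Finset.sum_add_distrib, hs, hs, ← two_smul ℝ, ← two_smul ℝ] at h2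
  exact smul_right_injective ℍ[ℝ] (two_ne_zero (α := ℝ)) h2

end Flip

/-! ### Replacing cycle products by their real parts -/

section Averaging

lemma List.prod_map_add_prod_map_eq {α : Type*} {L : List α} {a : α} (ha : a ∈ L) (hL : L.Nodup)
    {f f' g : α → ℍ[ℝ]} (h : ∀ x ∈ L, x ≠ a → f x = g x ∧ f' x = g x)
    (hs : f a + f' a = g a + g a) :
    (L.map f).prod + (L.map f').prod = (L.map g).prod + (L.map g).prod := by
  obtain ⟨l₁, l₂, rfl⟩ := List.append_of_mem ha
  have h₁ : ∀ x ∈ l₁, x ≠ a := fun x hx hxa => by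
    subst hxa
    exact (List.nodup_append.1 hL).2.2 x hx x List.mem_cons_self rfl
  have h₂ : ∀ x ∈ l₂, x ≠ a := fun x hx hxa => by
    subst hxa
    exact (List.nodup_cons.1 (List.nodup_append.1 hL).2.1).1 hx
  have e₁ : l₁.map f = l₁.map g := List.map_congr_left fun x hx => (h x (by simp [hx]) (h₁ x hx)).1
  have e₂ : l₂.map f = l₂.map g := List.map_congr_left fun x hx => (h x (by simp [hx]) (h₂ x hx)).1
  have e₁' : l₁.map f' = l₁.map g :=
    List.map_congr_left fun x hx => (h x (by simp [hx]) (h₁ x hx)).2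
  have e₂' : l₂.map f' = l₂.map g :=
    List.map_congr_left fun x hx => (h x (by simp [hx]) (h₂ x hx)).2
  simp only [List.map_append, List.map_cons, List.prod_append, List.prod_cons, e₁, e₂, e₁', e₂']
  rw [← mul_add, ← add_mul, hs, add_mul, mul_add]

variable {n : ℕ}

lemma cycleOpeners_nodup (σ : Equiv.Perm (Fin n)) (i : Fin n) : (cycleOpeners σ i).Nodup := by
  rw [cycleOpeners, List.nodup_cons]
  refine ⟨fun h => ?_, (List.nodup_finRange n).filter _⟩
  rw [List.mem_filter, decide_eq_true_eq] at h
  exact h.2.1 (Equiv.Perm.SameCycle.refl _ _)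

lemma eq_of_mem_cycleOpeners {σ : Equiv.Perm (Fin n)} {i x y : Fin n} (hx : x ∈ cycleOpeners σ i)
    (hy : y ∈ cycleOpeners σ i) (h : σ.SameCycle x y) : x = y := by
  simp only [cycleOpeners, List.mem_cons, List.mem_filter, decide_eq_true_eq] at hx hy
  rcases hx with rfl | ⟨-, hix, hx⟩ <;> rcases hy with rfl | ⟨-, hiy, hy⟩
  · rfl
  · exact absurd h hiy
  · exact absurd h.symm hix
  · exact le_antisymm (hx _ h) (hy _ h.symm)

open Classical in
/-- In a signed sum of products of cycle products, the cycle products that are conjugated when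
their cycle is inverted may be replaced by their real parts. The list `L σ` prescribes the opening
elements and the order of the factors, and `p` singles out the cycles to be treated. -/
theorem sum_prod_cycleProd_eq (M : Matrix (Fin n) (Fin n) ℍ[ℝ])
    (L : Equiv.Perm (Fin n) → List (Fin n)) (hflip : ∀ x σ, L (flipCycle x σ) = L σ)
    (hnodup : ∀ σ, (L σ).Nodup)
    (hL : ∀ σ, ∀ x ∈ L σ, ∀ y ∈ L σ, σ.SameCycle x y → x = y)
    (p : Equiv.Perm (Fin n) → Fin n → Prop) (hp : ∀ x y σ, p (flipCycle x σ) y ↔ p σ y)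
    (hstar : ∀ σ y, p σ y → cycleProd M (flipCycle y σ) y = star (cycleProd M σ y)) :
    ∑ σ, (Equiv.Perm.sign σ : ℤ) • ((L σ).map (cycleProd M σ)).prod =
      ∑ σ, (Equiv.Perm.sign σ : ℤ) • ((L σ).map fun x =>
        if p σ x then (((cycleProd M σ x).re : ℝ) : ℍ[ℝ]) else cycleProd M σ x).prod := by
  -- The cycles are treated one opening element at a time; `s` holds those already treated.
  let F : Finset (Fin n) → Equiv.Perm (Fin n) → Fin n → ℍ[ℝ] := fun s σ x =>
    if x ∈ s ∧ p σ x then (((cycleProd M σ x).re : ℝ) : ℍ[ℝ]) else cycleProd M σ x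
  have key : ∀ s : Finset (Fin n), ∑ σ, (Equiv.Perm.sign σ : ℤ) • ((L σ).map (cycleProd M σ)).prod =
      ∑ σ, (Equiv.Perm.sign σ : ℤ) • ((L σ).map (F s σ)).prod := by
    intro s
    induction s using Finset.induction_on with
    | empty => simp [F]
    | insert a s ha ih =>
      rw [ih]
      refine sum_eq_sum_of_flipCycle a fun σ => ?_
      rw [sign_flipCycle, hflip, ← smul_add, ← smul_add]
      congr 1
      by_cases haL : a ∈ L σ ∧ p σ a
      · obtain ⟨haL, hpa⟩ := haL
        have hne : ∀ x ∈ L σ, x ≠ a → ∀ s, F s (flipCycle a σ) x = F s σ x := by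
          intro x hx hxa s
          have : ¬ σ.SameCycle a x := fun h => hxa (hL σ a haL x hx h).symm
          simp only [F, hp, cycleProd_flipCycle_of_not_sameCycle M this]
        have hins : ∀ x, x ≠ a → ∀ τ, F s τ x = F (insert a s) τ x := by
          intro x hxa τ
          simp only [F, Finset.mem_insert, hxa, false_or]
        have hsecond : (L σ).map (F (insert a s) (flipCycle a σ)) =
            (L σ).map (F (insert a s) σ) := by
          refine List.map_congr_left fun x hx => ?_
          by_cases hxa : x = a
          · subst hxa
            simp [F, hp, hpa, hstar σ x hpa]
          · exact hne x hx hxa _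
        rw [hsecond]
        refine List.prod_map_add_prod_map_eq haL (hnodup σ) (fun x hx hxa => ?_) ?_
        · exact ⟨hins x hxa σ, by rw [hne x hx hxa, hins x hxa]⟩
        · simp only [F, ha, hp, hpa, hstar σ a hpa, Finset.mem_insert_self, false_and, if_false,
            and_self, if_true]
          rw [Quaternion.self_add_star, two_mul]
      · have hF : ∀ τ, (p τ a ↔ p σ a) → (L σ).map (F (insert a s) τ) = (L σ).map (F s τ) := by
          intro τ hτ
          refine List.map_congr_left fun x hx => ?_
          by_cases hxa : x = a
          · subst hxa
            have : ¬ p τ x := fun h => haL ⟨hx, hτ.1 h⟩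
            simp [F, this]
          · simp [F, hxa]
        rw [hF σ Iff.rfl, hF _ (hp a a σ)]
  simpa [F] using key Finset.univ

end Averaging

/-! ### Products over all cycles -/

section CycleLeaders

variable {n : ℕ}

open Classical in
/-- The least elements of the cycles of `σ`. -/
noncomputable def cycleLeaders (σ : Equiv.Perm (Fin n)) : Finset (Fin n) :=
  Finset.univ.filter fun x => ∀ y, σ.SameCycle x y → x ≤ y

lemma mem_cycleLeaders {σ : Equiv.Perm (Fin n)} {x : Fin n} :
    x ∈ cycleLeaders σ ↔ ∀ y, σ.SameCycle x y → x ≤ y := by simp [cycleLeaders]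

open Classical in
/-- A product over all cycles, with the factor of the cycle through `i` taken out. -/
lemma prod_cycleLeaders {R : Type*} [CommMonoid R] (σ : Equiv.Perm (Fin n)) (i : Fin n)
    (g : Fin n → R) (hg : ∀ x y, σ.SameCycle x y → g x = g y) :
    ∏ x ∈ cycleLeaders σ, g x =
      g i * ∏ x ∈ (cycleLeaders σ).filter (fun x => ¬ σ.SameCycle i x), g x := by
  rw [← Finset.prod_filter_mul_prod_filter_not (cycleLeaders σ) (fun x => σ.SameCycle i x)]
  congr 1
  obtain ⟨a, ha, hmin⟩ := Finset.exists_min_image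
    (Finset.univ.filter fun x => σ.SameCycle i x) id ⟨i, by simp [Equiv.Perm.SameCycle.refl]⟩
  simp only [Finset.mem_filter, Finset.mem_univ, true_and, id] at ha hmin
  have : (cycleLeaders σ).filter (fun x => σ.SameCycle i x) = {a} := by
    ext x
    rw [Finset.mem_filter, mem_cycleLeaders, Finset.mem_singleton]
    constructor
    · rintro ⟨hx, hix⟩
      exact le_antisymm (hx a (hix.symm.trans ha)) (hmin x hix)
    · rintro rfl
      exact ⟨fun y hy => hmin y (ha.trans hy), ha⟩
  rw [this, Finset.prod_singleton, hg i a ha]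

open Classical in
lemma prod_map_otherOpeners {R : Type*} [CommMonoid R] (σ : Equiv.Perm (Fin n)) (i : Fin n)
    (g : Fin n → R) :
    (((List.finRange n).filter fun x =>
      decide (¬ σ.SameCycle i x ∧ ∀ y, σ.SameCycle x y → x ≤ y)).map g).prod =
      ∏ x ∈ (cycleLeaders σ).filter (fun x => ¬ σ.SameCycle i x), g x := by
  rw [← List.prod_toFinset g ((List.nodup_finRange n).filter _)]
  refine Finset.prod_congr ?_ fun _ _ => rfl
  ext x
  simp [mem_cycleLeaders, and_comm]

lemma prod_cycleOpeners {R : Type*} [CommMonoid R] (σ : Equiv.Perm (Fin n)) (i : Fin n)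
    (g : Fin n → R) (hg : ∀ x y, σ.SameCycle x y → g x = g y) :
    ((cycleOpeners σ i).map g).prod = ∏ x ∈ cycleLeaders σ, g x := by
  classical
  rw [prod_cycleLeaders σ i g hg, ← prod_map_otherOpeners, cycleOpeners, List.map_cons,
    List.prod_cons]

end CycleLeaders

/-! ### The common value of the row and column determinants -/

section RealForm

variable {n : ℕ}

/-- The real number that is the common value of all row and column determinants of a Hermitian
matrix `M`: the signed sum of the products of the real parts of the cycle products. -/
noncomputable def mooreDet (M : Matrix (Fin n) (Fin n) ℍ[ℝ]) : ℝ :=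
  ∑ σ : Equiv.Perm (Fin n), (Equiv.Perm.sign σ : ℤ) • ∏ x ∈ cycleLeaders σ, (cycleProd M σ x).re

lemma coe_list_prod (l : List ℝ) : ((l.prod : ℝ) : ℍ[ℝ]) = (l.map (fun r : ℝ => (r : ℍ[ℝ]))).prod :=
  map_list_prod (algebraMap ℝ ℍ[ℝ]) l

/-- For a Hermitian matrix the signed sum does not depend on the order of the cycles, nor on the
element `i` that opens the first one. -/
lemma sum_perm_cycleOpeners_eq_mooreDet {M : Matrix (Fin n) (Fin n) ℍ[ℝ]} (hM : M.IsHermitian)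
    (i : Fin n) (L : Equiv.Perm (Fin n) → List (Fin n)) (hL : ∀ σ, (L σ).Perm (cycleOpeners σ i))
    (hflip : ∀ x σ, L (flipCycle x σ) = L σ) :
    ∑ σ : Equiv.Perm (Fin n), (Equiv.Perm.sign σ : ℤ) • ((L σ).map (cycleProd M σ)).prod =
      ((mooreDet M : ℝ) : ℍ[ℝ]) := by
  rw [sum_prod_cycleProd_eq M L hflip (fun σ => (hL σ).nodup_iff.2 (cycleOpeners_nodup σ i))
    (fun σ x hx y hy => eq_of_mem_cycleOpeners ((hL σ).mem_iff.1 hx) ((hL σ).mem_iff.1 hy))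
    (fun _ _ => True) (fun _ _ _ => Iff.rfl)
    (fun σ y _ => cycleProd_flipCycle_self fun a b _ _ => (hM.apply a b).symm)]
  have : ((mooreDet M : ℝ) : ℍ[ℝ]) = ∑ σ : Equiv.Perm (Fin n), (Equiv.Perm.sign σ : ℤ) •
      ((∏ x ∈ cycleLeaders σ, (cycleProd M σ x).re : ℝ) : ℍ[ℝ]) := by
    change algebraMap ℝ ℍ[ℝ] (mooreDet M) = _
    rw [mooreDet, map_sum]
    exact Finset.sum_congr rfl fun σ _ => map_zsmul _ _ _
  rw [this]
  refine Finset.sum_congr rfl fun σ _ => ?_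
  rw [← prod_cycleOpeners σ i _ fun x y h => (re_cycleProd_eq_of_sameCycle M h).symm,
    ← ((hL σ).map _).prod_eq, coe_list_prod, List.map_map]
  simp [Function.comp_def]

lemma rdet_eq_mooreDet {M : Matrix (Fin n) (Fin n) ℍ[ℝ]} (hM : M.IsHermitian) (i : Fin n) :
    rdet i M = ((mooreDet M : ℝ) : ℍ[ℝ]) :=
  sum_perm_cycleOpeners_eq_mooreDet hM i (fun σ => cycleOpeners σ i) (fun _ => List.Perm.refl _)
    fun _ _ => cycleOpeners_flipCycle i

lemma cdet_eq_mooreDet {M : Matrix (Fin n) (Fin n) ℍ[ℝ]} (hM : M.IsHermitian) (i : Fin n) :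
    cdet i M = ((mooreDet M : ℝ) : ℍ[ℝ]) :=
  sum_perm_cycleOpeners_eq_mooreDet hM i (fun σ => (cycleOpeners σ i).reverse)
    (fun _ => List.reverse_perm _) fun _ _ => by rw [cycleOpeners_flipCycle]

lemma hermDet_eq_mooreDet {M : Matrix (Fin n) (Fin n) ℍ[ℝ]} (hM : M.IsHermitian) :
    hermDet M = ((mooreDet M : ℝ) : ℍ[ℝ]) := by
  cases n with
  | zero => simp [hermDet, mooreDet, cycleLeaders]
  | succ n => exact rdet_eq_mooreDet hM 0

end RealForm

/-! ### Merging two cycles by a transposition -/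

section MulSwap

variable {n : ℕ} {σ τ : Equiv.Perm (Fin n)} {i j x y : Fin n}

/-- Under `τ * swap i j`, the orbit of `j` first runs through the cycle of `τ` through `i`. -/
lemma mul_swap_pow_apply (hij : ¬ τ.SameCycle i j) {k : ℕ} (hk : k < Function.minimalPeriod τ i) :
    ((τ * Equiv.swap i j) ^ (k + 1)) j = (τ ^ (k + 1)) i := by
  induction k with
  | zero => simp
  | succ k ih =>
    rw [pow_succ', Equiv.Perm.mul_apply, ih (by omega), Equiv.Perm.mul_apply,
      Equiv.swap_apply_of_ne_of_ne, pow_succ' τ (k + 1), Equiv.Perm.mul_apply]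
    · exact fun h => Function.not_isPeriodicPt_of_pos_of_lt_minimalPeriod (by omega) hk
        (isPeriodicPt_iff_pow.2 h)
    · exact fun h => hij (h ▸ sameCycle_pow_right_self (k + 1))

lemma mul_swap_pow_minimalPeriod (hij : ¬ τ.SameCycle i j) :
    ((τ * Equiv.swap i j) ^ Function.minimalPeriod τ i) j = i := by
  obtain ⟨p, hp⟩ := Nat.exists_eq_succ_of_ne_zero (minimalPeriod_perm_pos τ i).ne'
  have := mul_swap_pow_apply hij (k := p) (by omega)
  rw [← Nat.succ_eq_add_one, ← hp, pow_minimalPeriod_apply] at this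
  exact this

lemma minimalPeriod_mul_swap (hij : ¬ τ.SameCycle i j) :
    Function.minimalPeriod (τ * Equiv.swap i j : Equiv.Perm (Fin n)) j =
      Function.minimalPeriod τ i + Function.minimalPeriod τ j := by
  have hji : ¬ τ.SameCycle j i := fun h => hij h.symm
  set p := Function.minimalPeriod τ i with hp
  set q := Function.minimalPeriod τ j with hq
  have hpj : ((τ * Equiv.swap i j) ^ p) j = i := mul_swap_pow_minimalPeriod hij
  have hqi : ((τ * Equiv.swap i j) ^ q) i = j := by
    have := mul_swap_pow_minimalPeriod hji
    rwa [Equiv.swap_comm] at this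
  refine le_antisymm (Function.IsPeriodicPt.minimalPeriod_le ?_ (isPeriodicPt_iff_pow.2 ?_))
    (le_of_not_gt fun hlt => ?_)
  · exact Nat.add_pos_left (minimalPeriod_perm_pos τ i) _
  · rw [add_comm, pow_add, Equiv.Perm.mul_apply, hpj, hqi]
  · have hpos := minimalPeriod_perm_pos (τ * Equiv.swap i j) j
    have hper := pow_minimalPeriod_apply (σ := τ * Equiv.swap i j) (x := j)
    obtain ⟨m, hm⟩ := Nat.exists_eq_succ_of_ne_zero hpos.ne'
    rw [hm] at hper hlt
    rcases lt_or_ge m p with h | h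
    · rw [Nat.succ_eq_add_one, mul_swap_pow_apply hij h] at hper
      exact hij (by simpa only [hper] using sameCycle_pow_right_self (σ := τ) (x := i) (m + 1))
    · obtain ⟨l, rfl⟩ := Nat.exists_eq_add_of_le h
      have hl : l + 1 < q := by omega
      rw [show (p + l).succ = (l + 1) + p by omega, pow_add, Equiv.Perm.mul_apply, hpj,
        Equiv.swap_comm, mul_swap_pow_apply hji (by omega)] at hper
      exact Function.not_isPeriodicPt_of_pos_of_lt_minimalPeriod (by omega) hl
        (isPeriodicPt_iff_pow.2 hper)

/-- Multiplication by `swap i j` merges the cycles through `i` and `j`. If row `j` of `M` is equal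
to row `i`, the merged cycle opened at `j` starts with the former cycle through `i`. -/
lemma cycleProd_mul_swap {M : Matrix (Fin n) (Fin n) ℍ[ℝ]} (hM : ∀ y, M j y = M i y)
    (hij : ¬ τ.SameCycle i j) :
    cycleProd M (τ * Equiv.swap i j) j = cycleProd M τ i * cycleProd M τ j := by
  have hji : ¬ τ.SameCycle j i := fun h => hij h.symm
  rw [cycleProd_eq_pathProd, minimalPeriod_mul_swap hij, pathProd_add,
    mul_swap_pow_minimalPeriod hij, cycleProd_eq_pathProd, cycleProd_eq_pathProd]
  congr 1
  · refine pathProd_congr fun k hk => ?_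
    rw [mul_swap_pow_apply hij hk]
    cases k with
    | zero => exact hM _
    | succ k => rw [mul_swap_pow_apply hij (by omega)]
  · rw [Equiv.swap_comm]
    refine pathProd_congr fun k hk => ?_
    rw [mul_swap_pow_apply hji hk]
    cases k with
    | zero => exact (hM _).symm
    | succ k => rw [mul_swap_pow_apply hji (by omega)]

lemma sameCycle_mul_swap_of_not (hij : ¬ τ.SameCycle i j) :
    (τ * Equiv.swap i j).SameCycle i j :=
  (sameCycle_iff_exists_nat.2 ⟨_, mul_swap_pow_minimalPeriod hij⟩).symm

lemma not_sameCycle_mul_swap (hne : i ≠ j) (h : σ.SameCycle i j) :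
    ¬ (σ * Equiv.swap i j).SameCycle i j := by
  classical
  have hex : ∃ k : ℕ, (σ ^ k) j = i := sameCycle_iff_exists_nat.1 h.symm
  set p := Nat.find hex with hp
  have hpi : (σ ^ p) j = i := Nat.find_spec hex
  have hmin : ∀ k < p, (σ ^ k) j ≠ i := fun k hk => Nat.find_min hex hk
  have hp0 : 0 < p := by
    rcases Nat.eq_zero_or_pos p with h0 | h0
    · rw [h0] at hpi
      exact absurd hpi.symm hne
    · exact h0
  have hjne : ∀ t, 0 < t → t < p → (σ ^ t) j ≠ j := by
    intro t ht htp hj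
    refine hmin (p - t) (by omega) ?_
    rw [← hpi, ← Nat.sub_add_cancel htp.le, pow_add, Equiv.Perm.mul_apply, hj,
      Nat.add_sub_cancel]
  -- The new orbit of `i` stays in the arc from `σ j` to `i`, which avoids `j`.
  have key : ∀ k, ∃ t, 0 < t ∧ t ≤ p ∧ ((σ * Equiv.swap i j) ^ k) i = (σ ^ t) j := by
    intro k
    induction k with
    | zero => exact ⟨p, hp0, le_rfl, hpi.symm⟩
    | succ k ih =>
      obtain ⟨t, ht, htp, hk⟩ := ih
      rw [pow_succ', Equiv.Perm.mul_apply, hk, Equiv.Perm.mul_apply]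
      rcases htp.lt_or_eq with hlt | rfl
      · exact ⟨t + 1, by omega, hlt, by
          rw [Equiv.swap_apply_of_ne_of_ne (hmin t hlt) (hjne t ht hlt), pow_succ',
            Equiv.Perm.mul_apply]⟩
      · exact ⟨1, one_pos, hp0, by rw [hpi, Equiv.swap_apply_left, pow_one]⟩
  intro hs
  obtain ⟨k, hk⟩ := sameCycle_iff_exists_nat.1 hs
  obtain ⟨t, ht, htp, hkt⟩ := key k
  rw [hk] at hkt
  rcases htp.lt_or_eq with hlt | rfl
  · exact hjne t ht hlt hkt.symm
  · exact hne (hpi.symm.trans hkt.symm)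

lemma sameCycle_mul_swap_iff (hne : i ≠ j) :
    (τ * Equiv.swap i j).SameCycle i j ↔ ¬ τ.SameCycle i j :=
  ⟨fun h h' => not_sameCycle_mul_swap hne h' h, sameCycle_mul_swap_of_not⟩

lemma mul_swap_agree (hi : ¬ τ.SameCycle i x) (hj : ¬ τ.SameCycle j x) :
    ∀ y, τ.SameCycle x y → (τ * Equiv.swap i j) y = τ y := by
  intro y hy
  rw [Equiv.Perm.mul_apply, Equiv.swap_apply_of_ne_of_ne]
  · rintro rfl
    exact hi hy.symm
  · rintro rfl
    exact hj hy.symm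

/-- After multiplication by `swap i j`, the cycle through `j` is the union of the two cycles. -/
lemma sameCycle_mul_swap_right_iff (hij : ¬ τ.SameCycle i j) :
    (τ * Equiv.swap i j).SameCycle j x ↔ τ.SameCycle i x ∨ τ.SameCycle j x := by
  constructor
  · intro h
    by_contra! hc
    exact hc.2 ((sameCycle_iff_of_agree (mul_swap_agree hc.1 hc.2)).1 h.symm).symm
  · have hs := sameCycle_mul_swap_of_not hij
    set σ := τ * Equiv.swap i j with hσ
    have hstep : ∀ a, σ.SameCycle a (τ a) := by
      intro a
      have : τ a = σ (Equiv.swap i j a) := by simp [hσ]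
      rw [this, Equiv.Perm.sameCycle_apply_right]
      by_cases hai : a = i
      · rw [hai, Equiv.swap_apply_left]
        exact hs
      · by_cases haj : a = j
        · rw [haj, Equiv.swap_apply_right]
          exact hs.symm
        · rw [Equiv.swap_apply_of_ne_of_ne hai haj]
    have hall : ∀ a b, τ.SameCycle a b → σ.SameCycle a b := by
      intro a b hab
      obtain ⟨k, rfl⟩ := sameCycle_iff_exists_nat.1 hab
      clear hab
      induction k with
      | zero => exact Equiv.Perm.SameCycle.refl _ _
      | succ k ih =>
        rw [pow_succ', Equiv.Perm.mul_apply]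
        exact ih.trans (hstep _)
    rintro (h | h)
    · exact hs.symm.trans (hall _ _ h)
    · exact hall _ _ h

end MulSwap

/-! ### Equal rows, cofactors and Cramer's rule -/

section RowExpansion

variable {n : ℕ} {M B B' : Matrix (Fin n) (Fin n) ℍ[ℝ]} {σ τ : Equiv.Perm (Fin n)} {i j : Fin n}

open Classical in
/-- The product of the real parts of the products of the cycles of `σ` not through `j`. -/
noncomputable def otherCyclesProd (M : Matrix (Fin n) (Fin n) ℍ[ℝ]) (σ : Equiv.Perm (Fin n))
    (j : Fin n) : ℝ :=
  ∏ x ∈ (cycleLeaders σ).filter (fun x => ¬ σ.SameCycle j x), (cycleProd M σ x).re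

/-- If `M` is Hermitian apart from its `j`-th row and column, then in `rdet j M` the cycles not
through `j` contribute their real parts only. -/
lemma rdet_eq_sum_cycleProd_mul (hM : ∀ a b, a ≠ j → b ≠ j → M a b = star (M b a)) :
    rdet j M = ∑ σ : Equiv.Perm (Fin n), (Equiv.Perm.sign σ : ℤ) •
      (cycleProd M σ j * ((otherCyclesProd M σ j : ℝ) : ℍ[ℝ])) := by
  classical
  rw [rdet, sum_prod_cycleProd_eq M (fun σ => cycleOpeners σ j)
    (fun _ _ => cycleOpeners_flipCycle j) (fun σ => cycleOpeners_nodup σ j)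
    (fun σ x hx y hy => eq_of_mem_cycleOpeners hx hy) (fun σ x => ¬ σ.SameCycle j x)
    (fun _ _ _ => not_congr sameCycle_flipCycle)]
  · refine Finset.sum_congr rfl fun σ _ => ?_
    rw [cycleOpeners, List.map_cons, List.prod_cons,
      if_neg (not_not.2 (Equiv.Perm.SameCycle.refl σ j)), otherCyclesProd,
      ← prod_map_otherOpeners, coe_list_prod, List.map_map]
    congr 3
    refine List.map_congr_left fun x hx => ?_
    rw [List.mem_filter, decide_eq_true_eq] at hx
    exact if_pos hx.2.1
  · intro σ y hy
    refine cycleProd_flipCycle_self fun a b ha hb => hM a b ?_ ?_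
    · rintro rfl
      exact hy ha.symm
    · rintro rfl
      exact hy hb.symm

lemma otherCyclesProd_congr (h : ∀ a b, a ≠ j → b ≠ j → B a b = B' a b)
    (σ : Equiv.Perm (Fin n)) : otherCyclesProd B σ j = otherCyclesProd B' σ j := by
  refine Finset.prod_congr rfl fun x hx => ?_
  rw [Finset.mem_filter] at hx
  congr 1
  refine cycleProd_eq_of_agree (fun _ _ => rfl) fun y hy => h _ _ ?_ ?_
  · rintro rfl
    exact hx.2 hy.symm
  · intro hj
    exact hx.2 (hj ▸ (Equiv.Perm.sameCycle_apply_right.2 hy)).symm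

open Classical in
/-- If `i` and `j` lie in different cycles of `τ`, then the cycles of `τ` not through `j` are the
cycle through `i` and the cycles of `τ * swap i j` not through `j`. -/
lemma otherCyclesProd_eq_re_mul (hij : ¬ τ.SameCycle i j) :
    otherCyclesProd M τ j =
      (cycleProd M τ i).re * otherCyclesProd M (τ * Equiv.swap i j) j := by
  have hji : ¬ τ.SameCycle j i := fun h => hij h.symm
  rw [otherCyclesProd, otherCyclesProd, Finset.prod_filter,
    prod_cycleLeaders τ i (fun x => if ¬ τ.SameCycle j x then (cycleProd M τ x).re else 1),
    if_pos hji]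
  · congr 1
    rw [← Finset.prod_filter, Finset.filter_filter]
    have hset : (cycleLeaders τ).filter (fun x => ¬ τ.SameCycle i x ∧ ¬ τ.SameCycle j x) =
        (cycleLeaders (τ * Equiv.swap i j)).filter
          (fun x => ¬ (τ * Equiv.swap i j).SameCycle j x) := by
      ext x
      rw [Finset.mem_filter, Finset.mem_filter, sameCycle_mul_swap_right_iff hij, not_or]
      refine and_congr_left fun h => ?_
      simp only [mem_cycleLeaders, sameCycle_iff_of_agree (mul_swap_agree h.1 h.2)]
    rw [← hset]
    refine Finset.prod_congr rfl fun x hx => ?_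
    rw [Finset.mem_filter] at hx
    rw [cycleProd_eq_of_agree (mul_swap_agree hx.2.1 hx.2.2) fun _ _ => rfl]
  · intro x y hxy
    have : τ.SameCycle j x ↔ τ.SameCycle j y := ⟨fun h => h.trans hxy, fun h => h.trans hxy.symm⟩
    simp only [this, re_cycleProd_eq_of_sameCycle M hxy]

open Classical in
lemma otherCyclesProd_mul_swap_flipCycle (hij : ¬ τ.SameCycle i j) :
    otherCyclesProd M (flipCycle i τ * Equiv.swap i j) j =
      otherCyclesProd M (τ * Equiv.swap i j) j := by
  have hij' : ¬ (flipCycle i τ).SameCycle i j := mt sameCycle_flipCycle.1 hij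
  have hset : ∀ τ : Equiv.Perm (Fin n), ¬ τ.SameCycle i j →
      otherCyclesProd M (τ * Equiv.swap i j) j =
        ∏ x, if ¬ τ.SameCycle i x ∧ ¬ τ.SameCycle j x ∧ x ∈ cycleLeaders τ then
          (cycleProd M τ x).re else 1 := by
    intro τ hij
    rw [otherCyclesProd, ← Finset.prod_filter]
    refine Finset.prod_congr ?_ fun x hx => ?_
    · ext x
      rw [Finset.mem_filter, Finset.mem_filter, sameCycle_mul_swap_right_iff hij, not_or]
      by_cases h : ¬ τ.SameCycle i x ∧ ¬ τ.SameCycle j x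
      · simp [mem_cycleLeaders, sameCycle_iff_of_agree (mul_swap_agree h.1 h.2), h]
      · simp only [h, and_false, false_iff, not_and]
        tauto
    · rw [Finset.mem_filter] at hx
      rw [cycleProd_eq_of_agree (mul_swap_agree hx.2.1 hx.2.2.1) fun _ _ => rfl]
  rw [hset _ hij, hset _ hij']
  refine Finset.prod_congr rfl fun x _ => ?_
  by_cases h : τ.SameCycle i x
  · simp [sameCycle_flipCycle, h]
  · simp only [mem_cycleLeaders, sameCycle_flipCycle, cycleProd_flipCycle_of_not_sameCycle M h]

/-- The `j`-th row determinant of a matrix with two equal rows `i` and `j` vanishes if the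
matrix is Hermitian apart from its `j`-th row and column. -/
theorem rdet_eq_zero_of_row_eq (hne : i ≠ j) (hM : ∀ a b, a ≠ j → b ≠ j → M a b = star (M b a))
    (hrow : ∀ y, M j y = M i y) : rdet j M = 0 := by
  classical
  rw [rdet_eq_sum_cycleProd_mul hM]
  set T : Equiv.Perm (Fin n) → ℍ[ℝ] := fun σ => (Equiv.Perm.sign σ : ℤ) •
      (cycleProd M σ j * ((otherCyclesProd M σ j : ℝ) : ℍ[ℝ])) with hT
  -- Pair the permutations separating `i` and `j` with those joining them.
  have hsplit : ∑ σ, T σ =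
      ∑ σ, if σ.SameCycle i j then 0 else T σ + T (σ * Equiv.swap i j) := by
    have h1 : ∑ σ : Equiv.Perm (Fin n), (if σ.SameCycle i j then T σ else 0) =
        ∑ σ, if σ.SameCycle i j then 0 else T (σ * Equiv.swap i j) := by
      rw [← Equiv.sum_comp (Equiv.mulRight (Equiv.swap i j))]
      refine Finset.sum_congr rfl fun σ _ => ?_
      simp only [Equiv.coe_mulRight, sameCycle_mul_swap_iff hne, ite_not]
    have h2 : ∀ σ : Equiv.Perm (Fin n), T σ =
        (if σ.SameCycle i j then 0 else T σ) + (if σ.SameCycle i j then T σ else 0) := by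
      intro σ
      split_ifs <;> simp
    rw [Finset.sum_congr rfl fun σ _ => h2 σ, Finset.sum_add_distrib, h1,
      ← Finset.sum_add_distrib]
    refine Finset.sum_congr rfl fun σ _ => ?_
    split_ifs <;> simp
  have hpair : ∀ σ : Equiv.Perm (Fin n), ¬ σ.SameCycle i j → T σ + T (σ * Equiv.swap i j) =
      (Equiv.Perm.sign σ : ℤ) • (((((cycleProd M σ i).re : ℝ) : ℍ[ℝ]) - cycleProd M σ i) *
        (cycleProd M σ j * ((otherCyclesProd M (σ * Equiv.swap i j) j : ℝ) : ℍ[ℝ]))) := by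
    intro σ hσ
    simp only [hT]
    rw [otherCyclesProd_eq_re_mul hσ, cycleProd_mul_swap hrow hσ, Equiv.Perm.sign_mul,
      Equiv.Perm.sign_swap hne, Quaternion.coe_mul, ← mul_assoc (cycleProd M σ j),
      ← Quaternion.coe_commutes _ (cycleProd M σ j)]
    simp only [mul_neg, mul_one, Units.val_neg, neg_smul, ← sub_eq_add_neg, ← smul_sub, mul_assoc,
      sub_mul]
  -- Inverting the cycle through `i` replaces its product by the conjugate.
  refine hsplit.trans ((sum_eq_sum_of_flipCycle (g := fun _ => 0) i fun σ => ?_).trans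
    Finset.sum_const_zero)
  simp only [sameCycle_flipCycle]
  split_ifs with h
  · rfl
  have hj : ∀ y, σ.SameCycle i y → y ≠ j := fun y hy hyj => h (hyj ▸ hy)
  rw [hpair σ h, hpair _ (mt sameCycle_flipCycle.1 h), sign_flipCycle,
    otherCyclesProd_mul_swap_flipCycle h, cycleProd_flipCycle_of_not_sameCycle M h,
    cycleProd_flipCycle_self fun a b ha hb => hM a b (hj a ha) (hj b hb), ← smul_add, ← add_mul,
    Quaternion.re_star]
  have : (((cycleProd M σ i).re : ℝ) : ℍ[ℝ]) - cycleProd M σ i +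
      ((((cycleProd M σ i).re : ℝ) : ℍ[ℝ]) - star (cycleProd M σ i)) = 0 := by
    rw [sub_add_sub_comm, Quaternion.self_add_star, two_mul, sub_self]
  rw [this, zero_mul, smul_zero, add_zero]

/-- The coefficient of the entry `(j, k)` in the expansion of the `j`-th row determinant along its
row `j`, for a Hermitian matrix `B`. The row of ones only strips the first factor, taken from
row `j`, off the product of the cycle through `j`. -/
noncomputable def rowCofactor (B : Matrix (Fin n) (Fin n) ℍ[ℝ]) (j k : Fin n) : ℍ[ℝ] :=
  ∑ σ : Equiv.Perm (Fin n), if σ j = k then (Equiv.Perm.sign σ : ℤ) •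
    (cycleProd (B.updateRow j 1) σ j * ((otherCyclesProd B σ j : ℝ) : ℍ[ℝ])) else 0

lemma cycleProd_updateRow (u : Fin n → ℍ[ℝ]) :
    cycleProd (B.updateRow j u) σ j = u (σ j) * cycleProd (B.updateRow j 1) σ j := by
  obtain ⟨p, hp⟩ := Nat.exists_eq_succ_of_ne_zero (minimalPeriod_perm_pos σ j).ne'
  rw [cycleProd_eq_pathProd, cycleProd_eq_pathProd, hp, Nat.succ_eq_add_one, pathProd_succ_left,
    pathProd_succ_left, Matrix.updateRow_self, Matrix.updateRow_self, Pi.one_apply, one_mul]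
  congr 1
  refine pathProd_congr fun k hk => ?_
  have hs : (σ ^ k) (σ j) = (σ ^ (k + 1)) j := by rw [pow_succ, Equiv.Perm.mul_apply]
  have : (σ ^ k) (σ j) ≠ j := by
    rw [hs]
    exact fun h => Function.not_isPeriodicPt_of_pos_of_lt_minimalPeriod (by omega)
      (by omega) (isPeriodicPt_iff_pow.2 h)
  rw [Matrix.updateRow_ne this, Matrix.updateRow_ne this]

lemma rdet_updateRow (hB : B.IsHermitian) (u : Fin n → ℍ[ℝ]) :
    rdet j (B.updateRow j u) = ∑ k, u k * rowCofactor B j k := by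
  rw [rdet_eq_sum_cycleProd_mul fun a b ha hb => by
    rw [Matrix.updateRow_ne ha, Matrix.updateRow_ne hb, hB.apply]]
  simp only [rowCofactor, Finset.mul_sum]
  rw [Finset.sum_comm]
  refine Finset.sum_congr rfl fun σ _ => ?_
  rw [Finset.sum_eq_single (σ j) (fun k _ hk => by rw [if_neg hk.symm, mul_zero])
    (fun h => absurd (Finset.mem_univ _) h), if_pos rfl, cycleProd_updateRow,
    otherCyclesProd_congr (B' := B) fun a b ha _ => by rw [Matrix.updateRow_ne ha],
    mul_smul_comm, mul_assoc]

/-- Cramer's rule: the cofactors along row `j` solve `B v = det B • e_j`. -/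
theorem mulVec_rowCofactor (hB : B.IsHermitian) (j : Fin n) :
    B *ᵥ rowCofactor B j = Pi.single j ((mooreDet B : ℝ) : ℍ[ℝ]) := by
  ext1 i
  change ∑ k, B i k * rowCofactor B j k = _
  rw [← rdet_updateRow hB (B i)]
  by_cases h : i = j
  · subst h
    rw [Matrix.updateRow_eq_self, rdet_eq_mooreDet hB, Pi.single_eq_same]
  · rw [Pi.single_eq_of_ne h]
    refine rdet_eq_zero_of_row_eq h (fun a b ha hb => ?_) fun y => ?_
    · rw [Matrix.updateRow_ne ha, Matrix.updateRow_ne hb, hB.apply]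
    · rw [Matrix.updateRow_self, Matrix.updateRow_ne h]

/-- The diagonal cofactor does not see row and column `j`. -/
lemma rowCofactor_self_congr (h : ∀ a b, a ≠ j → b ≠ j → B a b = B' a b) :
    rowCofactor B j j = rowCofactor B' j j := by
  refine Finset.sum_congr rfl fun σ _ => ?_
  split_ifs with hσ
  · have h1 : ∀ C : Matrix (Fin n) (Fin n) ℍ[ℝ], cycleProd (C.updateRow j 1) σ j = 1 := by
      intro C
      have : Function.minimalPeriod σ j = 1 := Function.minimalPeriod_eq_one_iff_isFixedPt.2 hσ
      rw [cycleProd_eq_pathProd, this, pathProd_succ_left, pathProd_zero, Matrix.updateRow_self,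
        Pi.one_apply, mul_one]
    rw [h1, h1, otherCyclesProd_congr h]
  · rfl

lemma mooreDet_one : mooreDet (1 : Matrix (Fin n) (Fin n) ℍ[ℝ]) = 1 := by
  have hc : ∀ (σ : Equiv.Perm (Fin n)) (x : Fin n), σ x ≠ x →
      cycleProd (1 : Matrix (Fin n) (Fin n) ℍ[ℝ]) σ x = 0 := by
    intro σ x hx
    obtain ⟨p, hp⟩ := Nat.exists_eq_succ_of_ne_zero (minimalPeriod_perm_pos σ x).ne'
    rw [cycleProd_eq_pathProd, hp, Nat.succ_eq_add_one, pathProd_succ_left,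
      Matrix.one_apply_ne hx.symm, zero_mul]
  rw [mooreDet, Finset.sum_eq_single 1]
  · rw [Finset.prod_eq_one]
    · simp
    · intro x _
      have : Function.minimalPeriod (1 : Equiv.Perm (Fin n)) x = 1 :=
        Function.minimalPeriod_eq_one_iff_isFixedPt.2 rfl
      rw [cycleProd_eq_pathProd, this, pathProd_succ_left, pathProd_zero, mul_one,
        Equiv.Perm.one_apply, Matrix.one_apply_eq, Quaternion.re_one]
  · intro σ _ hσ
    obtain ⟨x, hx⟩ : ∃ x, σ x ≠ x := by
      by_contra! h
      exact hσ (Equiv.ext h)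
    rw [prod_cycleLeaders σ x (fun x => (cycleProd 1 σ x).re)
      fun a b hab => (re_cycleProd_eq_of_sameCycle 1 hab).symm, hc σ x hx]
    simp
  · exact fun h => absurd (Finset.mem_univ _) h

end RowExpansion

/-! ### Gram matrices -/

section Gram

variable {m n : ℕ}

lemma coe_eq_zero_iff {r : ℝ} : (r : ℍ[ℝ]) = 0 ↔ r = 0 := by
  rw [← Quaternion.coe_zero, Quaternion.coe_inj]

lemma mulVec_apply_congr {B C : Matrix (Fin n) (Fin n) ℍ[ℝ]} {v : Fin n → ℍ[ℝ]} {x : Fin n}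
    (h : ∀ y, B x y * v y = C x y * v y) : (B *ᵥ v) x = (C *ᵥ v) x := by
  change ∑ y, B x y * v y = ∑ y, C x y * v y
  exact Finset.sum_congr rfl fun y _ => h y

lemma mulVec_eq_zero_of_star_dotProduct (A : Matrix (Fin m) (Fin n) ℍ[ℝ]) {v : Fin n → ℍ[ℝ]}
    (h : star v ⬝ᵥ ((Aᴴ * A) *ᵥ v) = 0) : A *ᵥ v = 0 := by
  rw [← Matrix.mulVec_mulVec, Matrix.dotProduct_mulVec, ← Matrix.star_mulVec] at h
  have h' : ((∑ i, Quaternion.normSq ((A *ᵥ v) i) : ℝ) : ℍ[ℝ]) = 0 := by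
    rw [← h, dotProduct]
    change algebraMap ℝ ℍ[ℝ] (∑ i, Quaternion.normSq ((A *ᵥ v) i)) = _
    rw [map_sum]
    exact Finset.sum_congr rfl fun i _ => (Quaternion.star_mul_self _).symm
  have h0 : ∑ i, Quaternion.normSq ((A *ᵥ v) i) = 0 := coe_eq_zero_iff.1 h'
  ext1 i
  exact Quaternion.normSq_eq_zero.1
    ((Finset.sum_eq_zero_iff_of_nonneg fun _ _ => Quaternion.normSq_nonneg).1 h0 i
      (Finset.mem_univ i))

/-- A vector `v` in the kernel of `A` satisfies `star v ᵥ* (Aᴴ * A) = 0`; multiplying by the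
cofactors along row `j` leaves `star (v j)` times the determinant. -/
lemma eq_zero_of_mulVec_eq_zero {A : Matrix (Fin m) (Fin n) ℍ[ℝ]} (hdet : mooreDet (Aᴴ * A) ≠ 0)
    {v : Fin n → ℍ[ℝ]} (hv : A *ᵥ v = 0) : v = 0 := by
  have hB : (Aᴴ * A).IsHermitian := Matrix.isHermitian_conjTranspose_mul_self A
  have h0 : star v ᵥ* (Aᴴ * A) = 0 := by
    rw [← Matrix.vecMul_vecMul, ← Matrix.star_mulVec, hv, star_zero, Matrix.zero_vecMul]
  ext1 j
  have h1 : star v ⬝ᵥ ((Aᴴ * A) *ᵥ rowCofactor (Aᴴ * A) j) = 0 := by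
    rw [Matrix.dotProduct_mulVec, h0, zero_dotProduct]
  rw [mulVec_rowCofactor hB, dotProduct_single, mul_eq_zero] at h1
  refine star_eq_zero.1 (h1.resolve_right ?_)
  exact mt coe_eq_zero_iff.1 hdet

/-- The matrix with the entries of `B` in the rows and columns of `S` and of the identity matrix
elsewhere; its determinant is the principal minor of `B` on `S`. -/
noncomputable def principalPart (B : Matrix (Fin n) (Fin n) ℍ[ℝ]) (S : Finset (Fin n)) :
    Matrix (Fin n) (Fin n) ℍ[ℝ] :=
  Matrix.of fun x y => if x ∈ S ∧ y ∈ S then B x y else (1 : Matrix (Fin n) (Fin n) ℍ[ℝ]) x y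

lemma principalPart_isHermitian {B : Matrix (Fin n) (Fin n) ℍ[ℝ]} (hB : B.IsHermitian)
    (S : Finset (Fin n)) : (principalPart B S).IsHermitian := by
  refine Matrix.IsHermitian.ext fun x y => ?_
  simp only [principalPart, Matrix.of_apply, and_comm (a := x ∈ S)]
  split_ifs
  · exact hB.apply x y
  · exact Matrix.isHermitian_one.apply x y

lemma principalPart_row_of_notMem (B : Matrix (Fin n) (Fin n) ℍ[ℝ]) {S : Finset (Fin n)}
    {x : Fin n} (hx : x ∉ S) (y : Fin n) :
    principalPart B S x y = (1 : Matrix (Fin n) (Fin n) ℍ[ℝ]) x y := by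
  simp [principalPart, hx]

/-- The principal parts of the Gram matrix of independent columns have trivial kernel. -/
lemma eq_zero_of_principalPart_mulVec {A : Matrix (Fin m) (Fin n) ℍ[ℝ]}
    (hA : ∀ v, A *ᵥ v = 0 → v = 0) (S : Finset (Fin n)) {v : Fin n → ℍ[ℝ]}
    (hv : principalPart (Aᴴ * A) S *ᵥ v = 0) : v = 0 := by
  have hout : ∀ x ∉ S, v x = 0 := by
    intro x hx
    have h := congrFun hv x
    have h' : (principalPart (Aᴴ * A) S *ᵥ v) x =
        ((1 : Matrix (Fin n) (Fin n) ℍ[ℝ]) *ᵥ v) x :=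
      mulVec_apply_congr fun y => by rw [principalPart_row_of_notMem _ hx]
    rwa [h', Matrix.one_mulVec] at h
  refine hA v (mulVec_eq_zero_of_star_dotProduct A (Finset.sum_eq_zero fun x _ => ?_))
  by_cases hx : x ∈ S
  · have h : ((Aᴴ * A) *ᵥ v) x = (principalPart (Aᴴ * A) S *ᵥ v) x := by
      refine mulVec_apply_congr fun y => ?_
      by_cases hy : y ∈ S
      · simp [principalPart, hx, hy]
      · rw [hout y hy, mul_zero, mul_zero]
    rw [h, hv, Pi.zero_apply, mul_zero]
  · rw [Pi.star_apply, hout x hx, star_zero, zero_mul]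

/-- Independent columns have a Gram matrix with nonzero determinant. The principal minors are
shown to be nonzero one after another: the minor on `S` is a coordinate of a vector that
the matrix of the next minor maps to a multiple, by that next minor, of a basis vector. -/
theorem mooreDet_ne_zero {A : Matrix (Fin m) (Fin n) ℍ[ℝ]} (hA : ∀ v, A *ᵥ v = 0 → v = 0) :
    mooreDet (Aᴴ * A) ≠ 0 := by
  have hB : (Aᴴ * A).IsHermitian := Matrix.isHermitian_conjTranspose_mul_self A
  have key : ∀ S : Finset (Fin n), mooreDet (principalPart (Aᴴ * A) S) ≠ 0 := by
    intro S
    induction S using Finset.induction_on with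
    | empty =>
      have : principalPart (Aᴴ * A) ∅ = 1 := by
        ext1 x y
        exact principalPart_row_of_notMem _ (Finset.notMem_empty x) y
      rw [this, mooreDet_one]
      exact one_ne_zero
    | insert j S hj ih =>
      intro h0
      apply ih
      have hv := mulVec_rowCofactor (principalPart_isHermitian hB (insert j S)) j
      rw [h0, Quaternion.coe_zero, Pi.single_zero] at hv
      have hvj := congrFun (eq_zero_of_principalPart_mulVec hA _ hv) j
      have hcof : rowCofactor (principalPart (Aᴴ * A) (insert j S)) j j =
          rowCofactor (principalPart (Aᴴ * A) S) j j :=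
        rowCofactor_self_congr fun a b ha hb => by
          simp [principalPart, Finset.mem_insert, ha, hb]
      have hexp := congrFun (mulVec_rowCofactor (principalPart_isHermitian hB S) j) j
      have hrow : (principalPart (Aᴴ * A) S *ᵥ rowCofactor (principalPart (Aᴴ * A) S) j) j =
          ((1 : Matrix (Fin n) (Fin n) ℍ[ℝ]) *ᵥ rowCofactor (principalPart (Aᴴ * A) S) j) j :=
        mulVec_apply_congr fun y => by rw [principalPart_row_of_notMem _ hj]
      rw [hrow, Matrix.one_mulVec, ← hcof, hvj, Pi.single_eq_same, Pi.zero_apply] at hexp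
      exact coe_eq_zero_iff.1 hexp.symm
  have hfull : principalPart (Aᴴ * A) Finset.univ = Aᴴ * A := by
    ext1 x y
    simp [principalPart]
  exact hfull ▸ key Finset.univ

lemma mooreDet_ne_zero_iff (A : Matrix (Fin m) (Fin n) ℍ[ℝ]) :
    mooreDet (Aᴴ * A) ≠ 0 ↔ ∀ v, A *ᵥ v = 0 → v = 0 :=
  ⟨fun h _ hv => eq_zero_of_mulVec_eq_zero h hv, mooreDet_ne_zero⟩

lemma linearIndependent_col_iff (A : Matrix (Fin m) (Fin n) ℍ[ℝ]) :
    LinearIndependent (ℍ[ℝ])ᵐᵒᵖ (fun j : Fin n => A.col j) ↔ ∀ v, A *ᵥ v = 0 → v = 0 := by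
  have hsum : ∀ v : Fin n → ℍ[ℝ], ∑ j, MulOpposite.op (v j) • A.col j = A *ᵥ v := by
    intro v
    ext1 i
    rw [Finset.sum_apply]
    rfl
  rw [Fintype.linearIndependent_iff]
  constructor
  · intro h v hv
    ext1 j
    exact MulOpposite.op_injective (h (fun j => MulOpposite.op (v j)) ((hsum v).trans hv) j)
  · intro h g hg j
    have := congrFun (h (fun j => (g j).unop) ((hsum _).symm.trans hg)) j
    exact MulOpposite.unop_injective this

lemma linearIndependent_row_conjTranspose_iff (A : Matrix (Fin m) (Fin n) ℍ[ℝ]) :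
    LinearIndependent ℍ[ℝ] (fun j : Fin n => Aᴴ.row j) ↔ ∀ v, A *ᵥ v = 0 → v = 0 := by
  have hsum : ∀ v : Fin n → ℍ[ℝ], ∑ j, v j • Aᴴ.row j = star (A *ᵥ star v) := by
    intro v
    rw [Matrix.star_mulVec, star_star]
    ext1 i
    rw [Finset.sum_apply]
    rfl
  rw [Fintype.linearIndependent_iff]
  constructor
  · intro h v hv
    ext1 j
    refine star_eq_zero.1 (h (star v) ?_ j)
    rw [hsum, star_star, hv, star_zero]
  · intro h g hg j
    rw [hsum, star_eq_zero] at hg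
    exact star_eq_zero.1 (congrFun (h _ hg) j)

end Gram

theorem theorem6p6 (m n : ℕ) (A : Matrix (Fin m) (Fin n) ℍ[ℝ]) :
    (∀ i : Fin n, rdet i (Aᴴ * A) = hermDet (Aᴴ * A) ∧ cdet i (Aᴴ * A) = hermDet (Aᴴ * A)) ∧
    (hermDet (Aᴴ * A) ≠ 0 ↔ LinearIndependent (ℍ[ℝ])ᵐᵒᵖ (fun j : Fin n => A.col j)) ∧
    (hermDet (Aᴴ * A) ≠ 0 ↔ LinearIndependent ℍ[ℝ] (fun j : Fin n => Aᴴ.row j)) := by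
  have hB : (Aᴴ * A).IsHermitian := Matrix.isHermitian_conjTranspose_mul_self A
  have hne : hermDet (Aᴴ * A) ≠ 0 ↔ ∀ v, A *ᵥ v = 0 → v = 0 := by
    rw [hermDet_eq_mooreDet hB, ← mooreDet_ne_zero_iff]
    exact not_congr coe_eq_zero_iff
  refine ⟨fun i => ?_, ?_, ?_⟩
  · rw [rdet_eq_mooreDet hB, cdet_eq_mooreDet hB, hermDet_eq_mooreDet hB]
    exact ⟨rfl, rfl⟩
  · rw [hne, linearIndependent_col_iff]
  · rw [hne, linearIndependent_row_conjTranspose_iff]
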